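/- Fix an interest rate $r\in\mathbb R$ and a horizon $T>0$. Let $X$ and $Y$ be (strictly) positive semimartingales on a time window $[0,S]$, with respect to their own natural filtrations, defined on probability spaces $(\Omega_X,\mathfrak F^X,P^X)$ and $(\Omega_Y,\mathfrak F^Y,P^Y)$. They are called NAP-equivalent if there exist probability measures $Q^X\sim P^X$ on $\Omega_X$ and $Q^Y\sim P^Y$ on $\Omega_Y$ (pricing measures) such that 1. $(e^{-rt}X_t)_{0\le t\le S}$ is a $Q^X$-martingale and $(e^{-rt}Y_t)_{0\le t\le S}$ is a $Q^Y$-martingale (for the natural filtrations of $X$ and $Y$); 2. for all $0\le s<t\le S$ and all bounded measurable $f:\mathbb R\to\mathbb R$, $E_{Q^X}[f(X_t)\mid X_s=z]=E_{Q^Y}[f(Y_t)\mid Y_s=z]$, that is, there is a measurable function of $z$ that is a version of both conditional expectations. **Proposition.** Let $X^1,X^2$ be processes on $[0,T]$ defined on $(\Omega_X,\mathfrak F^X,P^X)$ and $Y^1,Y^2$ processes on $[0,T]$ defined on $(\Omega_Y,\mathfrak F^Y,P^Y)$. Suppose that for $i=1,2$ the processes $X^i$ and $Y^i$ are NAP-equivalent,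 with pricing measures $Q^{X^i}$ and $Q^{Y^i}$ (the choice $Q^{X^1}=Q^{X^2}$, $Q^{Y^1}=Q^{Y^2}$ is allowed). Assume that * $X^i$ under $Q^{X^i}$ and $Y^i$ under $Q^{Y^i}$ are time-homogeneous Markov processes, $i=1,2$; * $X^1$ and $X^2$ are independent under $Q^{X^1}$ and under $Q^{X^2}$, and $Y^1$ and $Y^2$ are independent under $Q^{Y^1}$ and under $Q^{Y^2}$; * the law of $X^1_0$ under $Q^{X^1}$ equals the law of $Y^1_0$ under $Q^{Y^1}$; * $X^2_0=1$ and $Y^2_0=1$ almost surely. Define the concatenations on $[0,2T]$ $$X_t=\begin{cases}X^1_t,&0\le t\le T,\\ X^1_T\,X^2_{t-T},&T<t\le 2T,\end{cases}\qquad Y_t=\begin{cases}Y^1_t,&0\le t\le T,\\ Y^1_T\,Y^2_{t-T},&T<t\le 2T.\end{cases}$$ Then $X$ and $Y$ are NAP-equivalent; in particular they are positive semimartingales on $[0,2T]$. -/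

import Mathlib

open MeasureTheory ProbabilityTheory Filter Topology
open scoped NNReal ENNReal

namespace NAP

/-- The time window `[0, T]`; a real-valued stochastic process on it is a map
`Window T → Ω → ℝ`. -/
abbrev Window (T : ℝ) : Type := Set.Icc (0 : ℝ) T

/-- Càdlàg functions on `[0, T]`: right-continuous with (finite) left limits.
At `t = 0` the left-limit clause is void. -/
def IsCadlag {T : ℝ} (x : Window T → ℝ) : Prop :=
  ∀ t : Window T,
    ContinuousWithinAt x (Set.Ici t) t ∧ ∃ l : ℝ, Tendsto x (𝓝[<] t) (𝓝 l)

/-- An elementary predictable integrand `H = ∑_{i < n} h i · 1_{(t i, t (i+1)]}` bounded by `1`: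
the times `t 0 ≤ t 1 ≤ …` lie in `[0, T]`, and `h i` is `ℱ (t i)`-measurable. -/
structure ElementaryIntegrand {Ω : Type*} {mΩ : MeasurableSpace Ω} {T : ℝ}
    (ℱ : Filtration (Window T) mΩ) where
  n : ℕ
  t : ℕ → Window T
  mono : Monotone t
  h : ℕ → Ω → ℝ
  measurable : ∀ i, Measurable[ℱ (t i)] (h i)
  bound : ∀ i ω, |h i ω| ≤ 1

/-- The elementary stochastic integral `∫_0^T H dX`. -/
def ElementaryIntegrand.integral {Ω : Type*} {mΩ : MeasurableSpace Ω} {T : ℝ}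
    {ℱ : Filtration (Window T) mΩ} (H : ElementaryIntegrand ℱ)
    (X : Window T → Ω → ℝ) (ω : Ω) : ℝ :=
  ∑ i ∈ Finset.range H.n, H.h i ω * (X (H.t (i + 1)) ω - X (H.t i) ω)

/-- Semimartingales on `[0, T]`, in the sense of stochastic integrators (Bichteler, Dellacherie):
adapted processes with almost surely càdlàg paths for which the elementary integrals of
integrands bounded by `1` form a set bounded in `P`-probability. -/
structure IsSemimartingale {Ω : Type*} {mΩ : MeasurableSpace Ω} {T : ℝ}
    (X : Window T → Ω → ℝ) (ℱ : Filtration (Window T) mΩ) (P : Measure Ω) : Prop where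
  adapted : ∀ t, Measurable[ℱ t] (X t)
  cadlag : ∀ᵐ ω ∂P, IsCadlag fun t => X t ω
  integrator : ∀ ε : ℝ≥0∞, 0 < ε → ∃ C : ℝ, ∀ H : ElementaryIntegrand ℱ,
    P {ω | C < |H.integral X ω|} ≤ ε

/-- A positive semimartingale on `[0, T]`, with respect to its own (minimal) filtration. -/
structure IsPositiveSemimartingale {Ω : Type*} {mΩ : MeasurableSpace Ω} {T : ℝ}
    (X : Window T → Ω → ℝ) (P : Measure Ω) : Prop where
  stronglyMeasurable : ∀ t, StronglyMeasurable (X t)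
  pos : ∀ᵐ ω ∂P, ∀ t, 0 < X t ω
  semimartingale : IsSemimartingale X (Filtration.natural X stronglyMeasurable) P

/-- The forward price `e^{-rt} X_t`. -/
noncomputable def forwardPrice {Ω : Type*} {T : ℝ} (r : ℝ) (X : Window T → Ω → ℝ) :
    Window T → Ω → ℝ :=
  fun t ω => Real.exp (-r * (t : ℝ)) * X t ω

/-- `Q` is a pricing measure for `X`: a probability measure equivalent to `P` under which the
forward price of `X` is a martingale (for the minimal filtration of `X`). -/
structure IsPricingMeasure {Ω : Type*} {mΩ : MeasurableSpace Ω} {T : ℝ} (r : ℝ)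
    (X : Window T → Ω → ℝ) (P Q : Measure Ω) : Prop where
  isProbabilityMeasure : IsProbabilityMeasure Q
  ac : Q ≪ P
  ac' : P ≪ Q
  stronglyMeasurable : ∀ t, StronglyMeasurable (X t)
  martingale : Martingale (forwardPrice r X) (Filtration.natural X stronglyMeasurable) Q

/-- `E_{QX}[f(X_t) | X_s = z] = E_{QY}[f(Y_t) | Y_s = z]` for all `s < t` and all bounded
measurable `f`. As functions of `z`, these conditional expectations are defined up to null sets of
the laws of `X_s` and `Y_s`; they agree when one Borel function `g` of `z` is a version of both. -/
def SameConditionalExpectations {ΩX ΩY : Type*} {mX : MeasurableSpace ΩX}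
    {mY : MeasurableSpace ΩY} {T : ℝ}
    (X : Window T → ΩX → ℝ) (QX : Measure ΩX) (Y : Window T → ΩY → ℝ) (QY : Measure ΩY) : Prop :=
  ∀ s t : Window T, s < t → ∀ f : ℝ → ℝ, Measurable f → (∃ C : ℝ, ∀ x, |f x| ≤ C) →
    ∃ g : ℝ → ℝ, Measurable g ∧
      QX[fun ω => f (X t ω) | MeasurableSpace.comap (X s) inferInstance] =ᵐ[QX] (fun ω => g (X s ω)) ∧
      QY[fun ω => f (Y t ω) | MeasurableSpace.comap (Y s) inferInstance] =ᵐ[QY] (fun ω => g (Y s ω))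

/-- The positive semimartingales `X` (on `(ΩX, PX)`) and `Y` (on `(ΩY, PY)`) are NAP-equivalent
with pricing measures `QX` and `QY`. -/
structure NAPEquivalentVia {ΩX ΩY : Type*} {mX : MeasurableSpace ΩX} {mY : MeasurableSpace ΩY}
    {T : ℝ} (r : ℝ) (X : Window T → ΩX → ℝ) (PX QX : Measure ΩX)
    (Y : Window T → ΩY → ℝ) (PY QY : Measure ΩY) : Prop where
  posX : IsPositiveSemimartingale X PX
  posY : IsPositiveSemimartingale Y PY
  pricingX : IsPricingMeasure r X PX QX
  pricingY : IsPricingMeasure r Y PY QY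
  same : SameConditionalExpectations X QX Y QY

/-- NAP-equivalence of `X` and `Y` (for the interest rate `r`). -/
def NAPEquivalent {ΩX ΩY : Type*} {mX : MeasurableSpace ΩX} {mY : MeasurableSpace ΩY}
    {T : ℝ} (r : ℝ) (X : Window T → ΩX → ℝ) (PX : Measure ΩX)
    (Y : Window T → ΩY → ℝ) (PY : Measure ΩY) : Prop :=
  ∃ (QX : Measure ΩX) (QY : Measure ΩY), NAPEquivalentVia r X PX QX Y PY QY

/-- `X` is a time-homogeneous Markov process under `Q` (for its minimal filtration): there is a
semigroup `κ` of Markov kernels with `E[f(X_t) | ℱ_s] = ∫ f(y) κ_{t-s}(X_s, dy)`, `s ≤ t`. -/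
def IsTimeHomogeneousMarkov {Ω : Type*} {mΩ : MeasurableSpace Ω} {T : ℝ}
    (X : Window T → Ω → ℝ) (Q : Measure Ω) : Prop :=
  ∃ (hX : ∀ t, StronglyMeasurable (X t)) (κ : ℝ≥0 → Kernel ℝ ℝ),
    (∀ u, IsMarkovKernel (κ u)) ∧ κ 0 = Kernel.id ∧ (∀ u v, κ (u + v) = κ v ∘ₖ κ u) ∧
    ∀ s t : Window T, s ≤ t → ∀ f : ℝ → ℝ, Measurable f → (∃ C : ℝ, ∀ x, |f x| ≤ C) →
      Q[fun ω => f (X t ω) | Filtration.natural X hX s] =ᵐ[Q]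
        fun ω => ∫ y, f y ∂(κ (Real.toNNReal ((t : ℝ) - (s : ℝ))) (X s ω))

/-- Independence under `Q` of two processes, as random elements of the path space with the
product σ-algebra. -/
def IndepProcesses {Ω : Type*} {mΩ : MeasurableSpace Ω} {T : ℝ}
    (X₁ X₂ : Window T → Ω → ℝ) (Q : Measure Ω) : Prop :=
  IndepFun (fun ω (t : Window T) => X₁ t ω) (fun ω (t : Window T) => X₂ t ω) Q

/-- The multiplicative concatenation on `[0, 2T]`: `X¹_t` for `t ≤ T`, and `X¹_T · X²_{t-T}` for
`T < t`. -/
noncomputable def concat {Ω : Type*} {T : ℝ} (X₁ X₂ : Window T → Ω → ℝ) :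
    Window (2 * T) → Ω → ℝ :=
  fun t ω =>
    if h : (t : ℝ) ≤ T then X₁ ⟨t, t.2.1, h⟩ ω
    else
      X₁ ⟨T, by have h1 := t.2.1; have h2 := t.2.2; linarith, le_rfl⟩ ω *
        X₂ ⟨(t : ℝ) - T, by linarith, by have h2 := t.2.2; linarith⟩ ω

end NAP

/-! Everything happens on path space. Multiplying `Q₁` by the density of the law of the path of `X₂`
under `Q₂` with respect to its law under `Q₁`, evaluated along the path of `X₂`, gives an equivalent
measure `Q` under which the two paths are independent with laws taken from `Q₁` and `Q₂`
(`exists_indepFun_measure`). This `Q` prices the concatenation.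

Since `X₂` starts at 1, the concatenation is almost surely `X₁ (firstClock t) * X₂ (secondClock t)`,
where the clocks stop at and start from `T` and add up to `t`. The discounted product is a
martingale by Fubini: sections of an event of the past are events of each component's past
(`martingale_concat`). For the integrator property, freezing one path turns an integrand of the
concatenation into an integrand of the other component; independence and Fubini then preserve the
bound in probability, which returns to `P` by equivalence (`integrator_concat`).

Conditional expectations of `f (X_t)` given `X_s` depend only on the law of `(X_s, X_t)`. Equal
initial laws and equal transitions give each component the same two-time laws on the `X` and `Y`
sides; by independence, so do their products. -/

namespace NAP

/-! ### Change of measure, and conditional expectations as functions of joint laws. -/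

section Measure

variable {Ω E F : Type*} {mΩ : MeasurableSpace Ω} {mE : MeasurableSpace E} {mF : MeasurableSpace F}

theorem map_withDensity_comp (μ : Measure Ω) {f : Ω → E} (hf : Measurable f) {g : E → ℝ≥0∞}
    (hg : Measurable g) :
    (μ.withDensity fun ω => g (f ω)).map f = (μ.map f).withDensity g := by
  ext s hs
  rw [Measure.map_apply hf hs, withDensity_apply _ (hf hs), withDensity_apply _ hs,
    setLIntegral_map hs hg hf]

/-- Given two equivalent probability measures, the first of which makes `U` and `V` independent,
there is an equivalent probability measure under which `U` and `V` are independent, with the law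
of `U` taken from the first and the law of `V` from the second. -/
theorem exists_indepFun_measure (μ ν : Measure Ω) [IsProbabilityMeasure μ]
    [IsProbabilityMeasure ν] (hμν : μ ≪ ν) (hνμ : ν ≪ μ) {U : Ω → E} {V : Ω → F}
    (hU : Measurable U) (hV : Measurable V) (hUV : IndepFun U V μ) :
    ∃ ρ : Measure Ω, IsProbabilityMeasure ρ ∧ ρ ≪ μ ∧ μ ≪ ρ ∧ IndepFun U V ρ ∧
      ρ.map U = μ.map U ∧ ρ.map V = ν.map V := by
  have : IsProbabilityMeasure (μ.map U) := Measure.isProbabilityMeasure_map hU.aemeasurable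
  have : IsProbabilityMeasure (μ.map V) := Measure.isProbabilityMeasure_map hV.aemeasurable
  have : IsProbabilityMeasure (ν.map V) := Measure.isProbabilityMeasure_map hV.aemeasurable
  -- Reweighting a product law by a function of the second coordinate leaves it a product; this
  -- density replaces the second marginal by the law of `V` under `ν`.
  set g := (ν.map V).rnDeriv (μ.map V)
  have hg : Measurable g := Measure.measurable_rnDeriv _ _
  set ρ := μ.withDensity fun ω => g (V ω)
  have hpair : ρ.map (fun ω => (U ω, V ω)) = (μ.map U).prod (ν.map V) := by
    have h := map_withDensity_comp μ (hU.prodMk hV) (g := fun z => g z.2) (hg.comp measurable_snd)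
    rw [show ρ = μ.withDensity fun ω => g (V ω) from rfl, h,
      (indepFun_iff_map_prod_eq_prod_map_map hU.aemeasurable hV.aemeasurable).1 hUV,
      ← prod_withDensity_right hg, Measure.withDensity_rnDeriv_eq _ _ (hνμ.map hV)]
  have h1 : ρ.map U = μ.map U := by
    have := congrArg (Measure.map Prod.fst) hpair
    rwa [Measure.map_map measurable_fst (hU.prodMk hV), Measure.map_fst_prod, measure_univ,
      one_smul] at this
  have h2 : ρ.map V = ν.map V := by
    have := congrArg (Measure.map Prod.snd) hpair
    rwa [Measure.map_map measurable_snd (hU.prodMk hV), Measure.map_snd_prod, measure_univ,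
      one_smul] at this
  have hρ : IsProbabilityMeasure ρ := by
    constructor
    have := congrArg (fun m => m Set.univ) h1
    simpa [Measure.map_apply hU MeasurableSet.univ] using this
  refine ⟨ρ, hρ, withDensity_absolutelyContinuous _ _, ?_, ?_, h1, h2⟩
  -- The density is almost surely positive because the law of `V` under `μ` is absolutely continuous
  -- with respect to that under `ν`.
  · refine withDensity_absolutelyContinuous' (hg.comp hV).aemeasurable ?_
    have := ae_of_ae_map hV.aemeasurable (Measure.rnDeriv_pos' (hμν.map hV))
    filter_upwards [this] with ω hω using hω.ne'
  · rw [indepFun_iff_map_prod_eq_prod_map_map hU.aemeasurable hV.aemeasurable, hpair, h1, h2]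

/-- Uniform integrability of the single function dν/dμ. Passing to a measurable hull admits
arbitrary sets, such as the exceedance events of elementary integrals. -/
theorem exists_pos_forall_measure_le_of_absolutelyContinuous {μ ν : Measure Ω}
    [IsFiniteMeasure μ] [IsFiniteMeasure ν] (h : ν ≪ μ) {ε : ℝ≥0∞} (hε : 0 < ε) :
    ∃ δ > 0, ∀ s, μ s ≤ δ → ν s ≤ ε := by
  obtain ⟨δ, hδ, H⟩ := exists_pos_setLIntegral_lt_of_measure_lt
    (Measure.lintegral_rnDeriv_lt_top ν μ).ne hε.ne'
  obtain ⟨δ', hδ', hlt⟩ := exists_between hδ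
  refine ⟨δ', hδ', fun s hs => ?_⟩
  have := H (toMeasurable μ s) (by rw [measure_toMeasurable]; exact hs.trans_lt hlt)
  rw [Measure.setLIntegral_rnDeriv h] at this
  exact (measure_mono (subset_toMeasurable μ s)).trans this.le

theorem setIntegral_comp_preimage {μ : Measure Ω} {U : Ω → E} (hU : Measurable U)
    {f : E → ℝ} (hf : Measurable f) {S : Set E} (hS : MeasurableSet S) :
    ∫ ω in U ⁻¹' S, f (U ω) ∂μ = ∫ x in S, f x ∂(μ.map U) :=
  (setIntegral_map hS hf.aestronglyMeasurable hU.aemeasurable).symm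

/-- Conditional expectations of `f (X')` given `X` only depend on the law of `(X, X')`. -/
theorem exists_condExp_version_of_map_eq {ΩX ΩY : Type*} {mX : MeasurableSpace ΩX}
    {mY : MeasurableSpace ΩY} {μ : Measure ΩX} {ν : Measure ΩY} [IsProbabilityMeasure μ]
    [IsProbabilityMeasure ν] {X X' : ΩX → ℝ} {Y Y' : ΩY → ℝ} (hX : Measurable X)
    (hX' : Measurable X') (hY : Measurable Y) (hY' : Measurable Y')
    (h : μ.map (fun ω => (X ω, X' ω)) = ν.map (fun ω => (Y ω, Y' ω)))
    {f : ℝ → ℝ} (hf : Measurable f) {C : ℝ} (hC : ∀ x, |f x| ≤ C) :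
    ∃ g : ℝ → ℝ, Measurable g ∧
      μ[fun ω => f (X' ω) | MeasurableSpace.comap X inferInstance] =ᵐ[μ] (fun ω => g (X ω)) ∧
      ν[fun ω => f (Y' ω) | MeasurableSpace.comap Y inferInstance] =ᵐ[ν] (fun ω => g (Y ω)) := by
  -- Doob–Dynkin: `g` is built on the `X` side only. It serves for `Y` because the integrals that
  -- characterise it are integrals against the common joint law.
  obtain ⟨g, hg, hgeq⟩ := (stronglyMeasurable_condExp (μ := μ) (f := fun ω => f (X' ω))
    (m := MeasurableSpace.comap X inferInstance)).exists_eq_measurable_comp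
  have hXi : Integrable (fun ω => f (X' ω)) μ :=
    .of_bound (hf.comp hX').aestronglyMeasurable C (ae_of_all _ fun ω => hC _)
  have hYi : Integrable (fun ω => f (Y' ω)) ν :=
    .of_bound (hf.comp hY').aestronglyMeasurable C (ae_of_all _ fun ω => hC _)
  have hmarg : μ.map X = ν.map Y := by
    have := congrArg (Measure.map Prod.fst) h
    rwa [Measure.map_map measurable_fst (hX.prodMk hX'),
      Measure.map_map measurable_fst (hY.prodMk hY')] at this
  have hgXi : Integrable (fun ω => g (X ω)) μ := by
    have : Integrable (g ∘ X) μ := hgeq ▸ integrable_condExp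
    exact this
  have hgYi : Integrable (fun ω => g (Y ω)) ν := by
    have : Integrable g (ν.map Y) := by
      rw [← hmarg]
      exact (integrable_map_measure hg.aestronglyMeasurable hX.aemeasurable).2 hgXi
    exact (integrable_map_measure hg.aestronglyMeasurable hY.aemeasurable).1 this
  refine ⟨g, hg.measurable, by rw [hgeq]; rfl, ?_⟩
  refine (ae_eq_condExp_of_forall_setIntegral_eq hY.comap_le hYi
    (fun s _ _ => hgYi.integrableOn) ?_ ?_).symm
  · rintro _ ⟨A, hA, rfl⟩ -
    have hA2 : MeasurableSet (Prod.fst ⁻¹' A : Set (ℝ × ℝ)) := measurable_fst hA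
    have e1 : ∫ ω in X ⁻¹' A, f (X' ω) ∂μ = ∫ ω in Y ⁻¹' A, f (Y' ω) ∂ν := by
      have a := setIntegral_comp_preimage (μ := μ) (hX.prodMk hX')
        (hf.comp measurable_snd) hA2
      have b := setIntegral_comp_preimage (μ := ν) (hY.prodMk hY')
        (hf.comp measurable_snd) hA2
      rw [h] at a
      exact a.trans b.symm
    rw [← e1, setIntegral_comp_preimage hY hg.measurable hA, ← hmarg,
      ← setIntegral_comp_preimage hX hg.measurable hA,
      ← setIntegral_condExp hX.comap_le hXi ⟨A, hA, rfl⟩, hgeq]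
    rfl
  · exact (hg.comp_measurable (comap_measurable Y)).aestronglyMeasurable

/-- Rectangles determine a joint law, so indicators suffice as test functions. -/
theorem map_prodMk_real_prod_of_condExp_eq {ρ : Measure Ω} [IsProbabilityMeasure ρ]
    {Z Z' : Ω → ℝ} (hZ : Measurable Z) (hZ' : Measurable Z') {A B : Set ℝ} (hA : MeasurableSet A)
    (hB : MeasurableSet B) {g : ℝ → ℝ} (hg : Measurable g)
    (hgZ : ρ[fun ω => B.indicator (fun _ => (1 : ℝ)) (Z' ω) |
      MeasurableSpace.comap Z inferInstance] =ᵐ[ρ] (fun ω => g (Z ω))) :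
    (ρ.map fun ω => (Z ω, Z' ω)).real (A ×ˢ B) = ∫ x in A, g x ∂(ρ.map Z) := by
  rw [← setIntegral_comp_preimage hZ hg hA,
    ← setIntegral_congr_ae (hZ hA) (hgZ.mono fun ω hω _ => hω),
    setIntegral_condExp hZ.comap_le _ ⟨A, hA, rfl⟩, measureReal_def,
    Measure.map_apply (hZ.prodMk hZ') (hA.prod hB), ← measureReal_def]
  · have : (fun ω => B.indicator (fun _ => (1 : ℝ)) (Z' ω)) = (Z' ⁻¹' B).indicator 1 := rfl
    rw [this, setIntegral_indicator (hZ' hB)]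
    simp
    rfl
  · refine .of_bound ((measurable_const.indicator hB).comp hZ').aestronglyMeasurable 1
      (ae_of_all _ fun ω => ?_)
    by_cases hx : Z' ω ∈ B <;> simp [hx]

/-- The law of a pair is determined by the law of the first component and the conditional
expectations of bounded functions of the second one. -/
theorem map_prodMk_eq_of_condExp_eq {ΩX ΩY : Type*} {mX : MeasurableSpace ΩX}
    {mY : MeasurableSpace ΩY} {μ : Measure ΩX} {ν : Measure ΩY} [IsProbabilityMeasure μ]
    [IsProbabilityMeasure ν] {X X' : ΩX → ℝ} {Y Y' : ΩY → ℝ} (hX : Measurable X)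
    (hX' : Measurable X') (hY : Measurable Y) (hY' : Measurable Y')
    (hmarg : μ.map X = ν.map Y)
    (h : ∀ f : ℝ → ℝ, Measurable f → (∃ C : ℝ, ∀ x, |f x| ≤ C) → ∃ g : ℝ → ℝ, Measurable g ∧
      μ[fun ω => f (X' ω) | MeasurableSpace.comap X inferInstance] =ᵐ[μ] (fun ω => g (X ω)) ∧
      ν[fun ω => f (Y' ω) | MeasurableSpace.comap Y inferInstance] =ᵐ[ν] (fun ω => g (Y ω))) :
    μ.map (fun ω => (X ω, X' ω)) = ν.map (fun ω => (Y ω, Y' ω)) := by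
  have : IsProbabilityMeasure (μ.map fun ω => (X ω, X' ω)) :=
    Measure.isProbabilityMeasure_map (hX.prodMk hX').aemeasurable
  refine Measure.ext_prod fun {A B} hA hB => ?_
  have hb : ∀ x, |B.indicator (fun _ => (1 : ℝ)) x| ≤ 1 := fun x => by
    by_cases hx : x ∈ B <;> simp [hx]
  obtain ⟨g, hg, hgX, hgY⟩ := h (B.indicator fun _ => 1) (measurable_const.indicator hB) ⟨1, hb⟩
  have : IsProbabilityMeasure (ν.map fun ω => (Y ω, Y' ω)) :=
    Measure.isProbabilityMeasure_map (hY.prodMk hY').aemeasurable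
  have e := map_prodMk_real_prod_of_condExp_eq hX hX' hA hB hg hgX
  rw [hmarg, ← map_prodMk_real_prod_of_condExp_eq hY hY' hA hB hg hgY] at e
  rwa [measureReal_def, measureReal_def,
    ENNReal.toReal_eq_toReal_iff' (measure_ne_top _ _) (measure_ne_top _ _)] at e

end Measure

/-- A conditional-expectation identity for two factors passes to the product measure. -/
theorem setIntegral_prod_mul_congr {E F : Type*} {m₁ : MeasurableSpace E}
    {m₂ : MeasurableSpace F} {mE : MeasurableSpace E} {mF : MeasurableSpace F}
    {μ : Measure E} {ν : Measure F} [SFinite μ] [SFinite ν] (hm₁ : m₁ ≤ mE) (hm₂ : m₂ ≤ mF)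
    {f f' : E → ℝ} {g g' : F → ℝ} (hf : Integrable f μ) (hf' : Integrable f' μ)
    (hg : Integrable g ν) (hg' : Integrable g' ν)
    (hff' : ∀ A, MeasurableSet[m₁] A → ∫ x in A, f x ∂μ = ∫ x in A, f' x ∂μ)
    (hgg' : ∀ B, MeasurableSet[m₂] B → ∫ y in B, g y ∂ν = ∫ y in B, g' y ∂ν)
    {S : Set (E × F)} (hS : MeasurableSet[m₁.prod m₂] S) :
    ∫ z in S, f z.1 * g z.2 ∂(μ.prod ν) = ∫ z in S, f' z.1 * g' z.2 ∂(μ.prod ν) := by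
  have hS' : MeasurableSet S :=
    (sup_le_sup (MeasurableSpace.comap_mono hm₁) (MeasurableSpace.comap_mono hm₂) :
      m₁.prod m₂ ≤ mE.prod mF) S hS
  have hsl : ∀ x, MeasurableSet[m₂] (Prod.mk x ⁻¹' S) := fun x =>
    (@measurable_prodMk_left E F m₁ m₂ x) hS
  have hsr : ∀ y, MeasurableSet[m₁] ((fun x => (x, y)) ⁻¹' S) := fun y =>
    (@measurable_prodMk_right E F m₁ m₂ y) hS
  -- One factor is replaced at a time: each section of `S` lies in `m₂` (below, in `m₁`), so Fubini
  -- reduces the claim to the one-variable identity.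
  have h1 : ∫ z in S, f z.1 * g z.2 ∂(μ.prod ν) = ∫ z in S, f z.1 * g' z.2 ∂(μ.prod ν) := by
    rw [← integral_indicator hS', ← integral_indicator hS',
      integral_prod _ ((hf.mul_prod hg).indicator hS'),
      integral_prod _ ((hf.mul_prod hg').indicator hS')]
    refine integral_congr_ae (ae_of_all _ fun x => ?_)
    have key : ∀ k : F → ℝ, ∫ y, S.indicator (fun z : E × F => f z.1 * k z.2) (x, y) ∂ν
        = f x * ∫ y in Prod.mk x ⁻¹' S, k y ∂ν := fun k => by
      rw [← integral_const_mul, ← integral_indicator (hm₂ _ (hsl x))]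
      rfl
    simp only [key, hgg' _ (hsl x)]
  have h2 : ∫ z in S, f z.1 * g' z.2 ∂(μ.prod ν) = ∫ z in S, f' z.1 * g' z.2 ∂(μ.prod ν) := by
    rw [← integral_indicator hS', ← integral_indicator hS',
      integral_prod_symm _ ((hf.mul_prod hg').indicator hS'),
      integral_prod_symm _ ((hf'.mul_prod hg').indicator hS')]
    refine integral_congr_ae (ae_of_all _ fun y => ?_)
    have key : ∀ k : E → ℝ, ∫ x, S.indicator (fun z : E × F => k z.1 * g' z.2) (x, y) ∂μ
        = (∫ x in (fun x => (x, y)) ⁻¹' S, k x ∂μ) * g' y := fun k => by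
      rw [← integral_mul_const, ← integral_indicator (hm₁ _ (hsr y))]
      rfl
    simp only [key, hff' _ (hsr y)]
  rw [h1, h2]

/-! ### Path space, the two clocks, and consequences of independence. -/

section Path

variable {Ω : Type*} {mΩ : MeasurableSpace Ω} {T : ℝ}

/-- The random path of a process. -/
def path (X : Window T → Ω → ℝ) (ω : Ω) : Window T → ℝ := fun t => X t ω

theorem measurable_path {X : Window T → Ω → ℝ} (hX : ∀ t, StronglyMeasurable (X t)) :
    Measurable (path X) :=
  measurable_pi_lambda _ fun t => (hX t).measurable

/-- The σ-algebra on path space generated by the coordinates up to time `s`. -/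
@[reducible]
def past (s : Window T) : MeasurableSpace (Window T → ℝ) :=
  ⨆ j ≤ s, MeasurableSpace.comap (fun x => x j) inferInstance

theorem past_le (s : Window T) : past s ≤ MeasurableSpace.pi :=
  iSup₂_le fun j _ => (measurable_pi_apply j).comap_le

theorem measurable_past {s j : Window T} (h : j ≤ s) :
    Measurable[past s] fun x : Window T → ℝ => x j :=
  Measurable.of_comap_le (le_iSup₂_of_le j h le_rfl)

theorem natural_eq_comap_past {X : Window T → Ω → ℝ} (hX : ∀ t, StronglyMeasurable (X t))
    (s : Window T) :
    (Filtration.natural X hX s : MeasurableSpace Ω) = (past s).comap (path X) := by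
  simp only [past, MeasurableSpace.comap_iSup, MeasurableSpace.comap_comp]
  rfl

/-- The time spent in the first half of `[0, 2T]`. -/
def firstClock (t : Window (2 * T)) : Window T :=
  ⟨min t T, le_min t.2.1 (by have h1 := t.2.1; have h2 := t.2.2; linarith), min_le_right _ _⟩

/-- The time spent in the second half of `[0, 2T]`. -/
def secondClock (t : Window (2 * T)) : Window T :=
  ⟨max (t - T) 0, le_max_right _ _,
    max_le (by have h2 := t.2.2; linarith) (by have h1 := t.2.1; have h2 := t.2.2; linarith)⟩

theorem firstClock_mono : Monotone (firstClock (T := T)) := fun _ _ h =>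
  Subtype.mk_le_mk.2 (min_le_min_right _ h)

theorem secondClock_mono : Monotone (secondClock (T := T)) := fun _ _ h =>
  Subtype.mk_le_mk.2 (max_le_max_right _ (sub_le_sub_right (Subtype.coe_le_coe.2 h) _))

theorem firstClock_add_secondClock (t : Window (2 * T)) :
    (firstClock t : ℝ) + secondClock t = t := by
  simp only [firstClock, secondClock]
  rcases le_total (t : ℝ) T with h | h
  · rw [min_eq_left h, max_eq_right (by linarith)]; ring
  · rw [min_eq_right h, max_eq_left (by linarith)]; ring

theorem firstClock_of_le {t : Window (2 * T)} (h : (t : ℝ) ≤ T) :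
    firstClock t = ⟨t, t.2.1, h⟩ :=
  Subtype.ext (min_eq_left h)

theorem firstClock_of_ge (hT : 0 ≤ T) {t : Window (2 * T)} (h : T ≤ (t : ℝ)) :
    firstClock t = ⟨T, hT, le_rfl⟩ :=
  Subtype.ext (min_eq_right h)

theorem secondClock_of_le (hT : 0 ≤ T) {t : Window (2 * T)} (h : (t : ℝ) ≤ T) :
    secondClock t = ⟨0, le_rfl, hT⟩ :=
  Subtype.ext (max_eq_right (by linarith))

theorem secondClock_of_ge {t : Window (2 * T)} (h : T ≤ (t : ℝ)) :
    secondClock t = ⟨t - T, by linarith, by have h2 := t.2.2; linarith⟩ :=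
  Subtype.ext (max_eq_left (by linarith))

theorem concat_of_le (X₁ X₂ : Window T → Ω → ℝ) {t : Window (2 * T)} (h : (t : ℝ) ≤ T) :
    concat X₁ X₂ t = X₁ (firstClock t) := by
  funext ω
  rw [concat, dif_pos h, firstClock_of_le h]

theorem concat_of_lt (X₁ X₂ : Window T → Ω → ℝ) {t : Window (2 * T)} (h : T < (t : ℝ)) :
    concat X₁ X₂ t = fun ω => X₁ (firstClock t) ω * X₂ (secondClock t) ω := by
  have hT : 0 ≤ T := by have h1 := t.2.1; have h2 := t.2.2; linarith
  funext ω
  rw [concat, dif_neg (not_le.2 h), firstClock_of_ge hT h.le, secondClock_of_ge h.le]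

/-- Up to time `T` the second clock stands at 0, where `X₂` is 1, so one formula covers both halves.
-/
theorem concat_eq_mul (hT : 0 ≤ T) {X₁ X₂ : Window T → Ω → ℝ} {ω : Ω}
    (h : X₂ ⟨0, le_rfl, hT⟩ ω = 1) (t : Window (2 * T)) :
    concat X₁ X₂ t ω = X₁ (firstClock t) ω * X₂ (secondClock t) ω := by
  rcases le_or_gt (t : ℝ) T with ht | ht
  · rw [concat_of_le _ _ ht, secondClock_of_le hT ht, h, mul_one]
  · rw [concat_of_lt _ _ ht]

theorem stronglyMeasurable_concat {X₁ X₂ : Window T → Ω → ℝ}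
    (hX₁ : ∀ t, StronglyMeasurable (X₁ t)) (hX₂ : ∀ t, StronglyMeasurable (X₂ t))
    (t : Window (2 * T)) : StronglyMeasurable (concat X₁ X₂ t) := by
  rcases le_or_gt (t : ℝ) T with ht | ht
  · rw [concat_of_le _ _ ht]; exact hX₁ _
  · rw [concat_of_lt _ _ ht]; exact (hX₁ _).mul (hX₂ _)

/-- The past of the concatenation is contained in the past of the pair, run with the two clocks. -/
theorem natural_concat_le {X₁ X₂ : Window T → Ω → ℝ}
    (h : ∀ t, StronglyMeasurable (concat X₁ X₂ t)) (t : Window (2 * T)) :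
    (Filtration.natural (concat X₁ X₂) h t : MeasurableSpace Ω) ≤
      ((past (firstClock t)).prod (past (secondClock t))).comap
        fun ω => (path X₁ ω, path X₂ ω) := by
  refine iSup₂_le fun j hj => Measurable.comap_le ?_
  have h1 : Measurable[((past (firstClock t)).prod (past (secondClock t))).comap
      fun ω => (path X₁ ω, path X₂ ω)] (X₁ (firstClock j)) :=
    ((measurable_past (firstClock_mono hj)).comp
      (@measurable_fst _ _ (past (firstClock t)) (past (secondClock t)))).comp
      (comap_measurable _)
  have h2 : Measurable[((past (firstClock t)).prod (past (secondClock t))).comap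
      fun ω => (path X₁ ω, path X₂ ω)] (X₂ (secondClock j)) :=
    ((measurable_past (secondClock_mono hj)).comp
      (@measurable_snd _ _ (past (firstClock t)) (past (secondClock t)))).comp
      (comap_measurable _)
  rcases le_or_gt (j : ℝ) T with ht | ht
  · rw [concat_of_le _ _ ht]; exact h1
  · rw [concat_of_lt _ _ ht]; exact h1.mul h2

theorem integrable_path_of_martingale {r : ℝ} {X : Window T → Ω → ℝ} {Q : Measure Ω}
    {hX : ∀ t, StronglyMeasurable (X t)}
    (hM : Martingale (forwardPrice r X) (Filtration.natural X hX) Q) (t : Window T) :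
    Integrable (fun x : Window T → ℝ => Real.exp (-r * t) * x t) (Q.map (path X)) :=
  (integrable_map_measure ((measurable_pi_apply t).const_mul _).aestronglyMeasurable
    (measurable_path hX).aemeasurable).2 (hM.integrable t)

theorem setIntegral_path_of_martingale {r : ℝ} {X : Window T → Ω → ℝ} {Q : Measure Ω}
    [IsFiniteMeasure Q] {hX : ∀ t, StronglyMeasurable (X t)}
    (hM : Martingale (forwardPrice r X) (Filtration.natural X hX) Q) {s t : Window T}
    (hst : s ≤ t) {A : Set (Window T → ℝ)} (hA : MeasurableSet[past s] A) :
    ∫ x in A, Real.exp (-r * t) * x t ∂(Q.map (path X)) =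
      ∫ x in A, Real.exp (-r * s) * x s ∂(Q.map (path X)) := by
  rw [← setIntegral_comp_preimage (measurable_path hX) ((measurable_pi_apply t).const_mul _)
    (past_le s A hA), ← setIntegral_comp_preimage (measurable_path hX)
    ((measurable_pi_apply s).const_mul _) (past_le s A hA)]
  refine (hM.setIntegral_eq hst ?_).symm
  rw [natural_eq_comap_past]
  exact ⟨A, hA, rfl⟩

/-- The concatenation of independent martingales is a martingale. -/
theorem martingale_concat {r : ℝ} (hT : 0 ≤ T) {X₁ X₂ : Window T → Ω → ℝ}
    {Q Q₁ Q₂ : Measure Ω} [IsProbabilityMeasure Q] [IsProbabilityMeasure Q₁]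
    [IsProbabilityMeasure Q₂]
    {hX₁ : ∀ t, StronglyMeasurable (X₁ t)} {hX₂ : ∀ t, StronglyMeasurable (X₂ t)}
    (hM₁ : Martingale (forwardPrice r X₁) (Filtration.natural X₁ hX₁) Q₁)
    (hM₂ : Martingale (forwardPrice r X₂) (Filtration.natural X₂ hX₂) Q₂)
    (hQ : Q.map (fun ω => (path X₁ ω, path X₂ ω)) = (Q₁.map (path X₁)).prod (Q₂.map (path X₂)))
    (h0 : ∀ᵐ ω ∂Q, X₂ ⟨0, le_rfl, hT⟩ ω = 1)
    (h : ∀ t, StronglyMeasurable (concat X₁ X₂ t)) :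
    Martingale (forwardPrice r (concat X₁ X₂)) (Filtration.natural (concat X₁ X₂) h) Q := by
  have hpair : Measurable fun ω => (path X₁ ω, path X₂ ω) :=
    (measurable_path hX₁).prodMk (measurable_path hX₂)
  set F : Window (2 * T) → (Window T → ℝ) × (Window T → ℝ) → ℝ := fun t z =>
    (Real.exp (-r * firstClock t) * z.1 (firstClock t)) *
      (Real.exp (-r * secondClock t) * z.2 (secondClock t)) with hF
  have hFm : ∀ t, Measurable (F t) := fun t => by fun_prop
  have hFeq : ∀ t, forwardPrice r (concat X₁ X₂) t =ᵐ[Q]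
      fun ω => F t (path X₁ ω, path X₂ ω) := fun t => by
    filter_upwards [h0] with ω hω
    have : Real.exp (-r * t) =
        Real.exp (-r * firstClock t) * Real.exp (-r * secondClock t) := by
      rw [← Real.exp_add, ← mul_add, firstClock_add_secondClock]
    simp only [forwardPrice, hF, concat_eq_mul hT hω, this, path]
    ring
  have hFint : ∀ t, Integrable (F t) (Q.map fun ω => (path X₁ ω, path X₂ ω)) := fun t => by
    rw [hQ]
    exact (integrable_path_of_martingale hM₁ _).mul_prod (integrable_path_of_martingale hM₂ _)
  have hint : ∀ t, Integrable (forwardPrice r (concat X₁ X₂) t) Q := fun t =>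
    ((integrable_map_measure (hFm t).aestronglyMeasurable hpair.aemeasurable).1
      (hFint t)).congr (hFeq t).symm
  refine ⟨fun t => ((Filtration.stronglyAdapted_natural h) t).const_mul _, fun s t hst => ?_⟩
  refine (ae_eq_condExp_of_forall_setIntegral_eq (Filtration.le _ s) (hint t)
    (fun _ _ _ => (hint s).integrableOn) (fun A hA _ => ?_)
    (((Filtration.stronglyAdapted_natural h) s).const_mul _).aestronglyMeasurable).symm
  -- The identity is tested on the larger past of the pair, which is a product σ-algebra.
  obtain ⟨S, hS, rfl⟩ := natural_concat_le h s A hA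
  have hS' : MeasurableSet S :=
    (sup_le_sup (MeasurableSpace.comap_mono (past_le _)) (MeasurableSpace.comap_mono (past_le _)) :
      (past (firstClock s)).prod (past (secondClock s)) ≤ Prod.instMeasurableSpace) S hS
  have e : ∀ u, ∫ ω in (fun ω => (path X₁ ω, path X₂ ω)) ⁻¹' S,
      forwardPrice r (concat X₁ X₂) u ω ∂Q =
      ∫ z in S, F u z ∂((Q₁.map (path X₁)).prod (Q₂.map (path X₂))) := fun u => by
    rw [← hQ, ← setIntegral_comp_preimage hpair (hFm u) hS']
    exact setIntegral_congr_ae (hpair hS') ((hFeq u).mono fun ω hω _ => hω)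
  rw [e, e]
  exact (setIntegral_prod_mul_congr (past_le _) (past_le _)
    (integrable_path_of_martingale hM₁ _) (integrable_path_of_martingale hM₁ _)
    (integrable_path_of_martingale hM₂ _) (integrable_path_of_martingale hM₂ _)
    (fun B hB => setIntegral_path_of_martingale hM₁ (firstClock_mono hst) hB)
    (fun B hB => setIntegral_path_of_martingale hM₂ (secondClock_mono hst) hB) hS).symm

/-- The integrals of elementary integrands which depend on an additional independent random
element are bounded in probability. -/
theorem exists_bound_integral_of_indepFun {E : Type*} {mE : MeasurableSpace E}
    {X : Window T → Ω → ℝ} {V : Ω → E} {Q : Measure Ω} [IsProbabilityMeasure Q]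
    (hX : ∀ t, StronglyMeasurable (X t)) (hV : Measurable V) (hXV : IndepFun (path X) V Q)
    {ε : ℝ≥0∞}
    {C : ℝ} (hC : ∀ H : ElementaryIntegrand (Filtration.natural X hX),
      Q {ω | C < |H.integral X ω|} ≤ ε) (n : ℕ) {τ : ℕ → Window T} (hτ : Monotone τ)
    {φ : ℕ → (Window T → ℝ) × E → ℝ} (hφ : ∀ i, Measurable[(past (τ i)).prod mE] (φ i))
    (hφ1 : ∀ i z, |φ i z| ≤ 1) :
    Q {ω | C < |∑ i ∈ Finset.range n, φ i (path X ω, V ω) * (X (τ (i + 1)) ω - X (τ i) ω)|} ≤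
      ε := by
  have hp := measurable_path hX
  have hφm : ∀ i, Measurable (φ i) := fun i =>
    (hφ i).mono (sup_le_sup (MeasurableSpace.comap_mono (past_le _)) le_rfl) le_rfl
  set S : Set ((Window T → ℝ) × E) :=
    {z | C < |∑ i ∈ Finset.range n, φ i z * (z.1 (τ (i + 1)) - z.1 (τ i))|} with hSdef
  have hS : MeasurableSet S := measurableSet_lt measurable_const (by fun_prop)
  have : IsProbabilityMeasure (Q.map V) := Measure.isProbabilityMeasure_map hV.aemeasurable
  change Q ((fun ω => (path X ω, V ω)) ⁻¹' S) ≤ ε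
  rw [← Measure.map_apply (hp.prodMk hV) hS,
    (indepFun_iff_map_prod_eq_prod_map_map hp.aemeasurable hV.aemeasurable).1 hXV,
    Measure.prod_apply_symm hS]
  calc ∫⁻ y, (Q.map (path X)) ((fun x => (x, y)) ⁻¹' S) ∂(Q.map V)
      ≤ ∫⁻ _, ε ∂(Q.map V) := lintegral_mono fun y => ?_
    _ = ε := by simp
  -- With `y` frozen, the weights depend on the past of `X` alone, and the uniform bound `hC`
  -- applies.
  rw [Measure.map_apply hp (measurable_prodMk_right hS)]
  exact hC
    { n := n
      t := τ
      mono := hτ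
      h := fun i ω => φ i (path X ω, y)
      measurable := fun i => by
        rw [natural_eq_comap_past]
        exact ((hφ i).comp (@measurable_prodMk_right _ _ (past (τ i)) mE y)).comp
          (comap_measurable _)
      bound := fun i ω => hφ1 i _ }

end Path

/-! ### Càdlàg paths under time change and multiplication. -/

section Cadlag

variable {S T : ℝ}

theorem IsCadlag.comp_monotone {x : Window T → ℝ} (hx : IsCadlag x) {c : Window S → Window T}
    (hc : Continuous c) (hm : Monotone c) : IsCadlag fun t => x (c t) := by
  intro t
  refine ⟨(hx (c t)).1.comp hc.continuousWithinAt fun s hs => hm hs, ?_⟩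
  -- Either the clock is constant just before `t`, and the left limit is the value itself, or it
  -- approaches `c t` strictly from below.
  by_cases h : ∃ s < t, c s = c t
  · obtain ⟨s, hst, hs⟩ := h
    refine ⟨x (c t), tendsto_const_nhds.congr' ?_⟩
    filter_upwards [Ioo_mem_nhdsLT hst] with u hu
    rw [le_antisymm (hm hu.2.le) (hs ▸ hm hu.1.le)]
  · push Not at h
    obtain ⟨l, hl⟩ := (hx (c t)).2
    refine ⟨l, hl.comp (tendsto_nhdsWithin_iff.2 ⟨hc.continuousWithinAt, ?_⟩)⟩
    filter_upwards [self_mem_nhdsWithin] with s hs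
    exact lt_of_le_of_ne (hm (le_of_lt hs)) (h s hs)

theorem IsCadlag.mul {x y : Window T → ℝ} (hx : IsCadlag x) (hy : IsCadlag y) :
    IsCadlag fun t => x t * y t := by
  intro t
  obtain ⟨l, hl⟩ := (hx t).2
  obtain ⟨m, hm⟩ := (hy t).2
  exact ⟨(hx t).1.mul (hy t).1, l * m, hl.mul hm⟩

theorem continuous_firstClock : Continuous (firstClock (T := T)) :=
  Continuous.subtype_mk (by fun_prop) _

theorem continuous_secondClock : Continuous (secondClock (T := T)) :=
  Continuous.subtype_mk (by fun_prop) _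

end Cadlag

/-! ### The concatenation is a positive semimartingale with a pricing measure. -/

section Semimartingale

variable {Ω : Type*} {mΩ : MeasurableSpace Ω} {T : ℝ}

theorem exists_measure_lt_abs_le {Q : Measure Ω} [IsFiniteMeasure Q] {Z : Ω → ℝ}
    (hZ : Measurable Z) {ε : ℝ≥0∞} (hε : 0 < ε) : ∃ K : ℝ, 0 ≤ K ∧ Q {ω | K < |Z ω|} ≤ ε := by
  have h := tendsto_measure_iInter_atTop (μ := Q) (s := fun n : ℕ => {ω | (n : ℝ) < |Z ω|})
    (fun n => (measurableSet_lt measurable_const (by fun_prop)).nullMeasurableSet)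
    (fun m n hmn ω (hω : (n : ℝ) < |Z ω|) =>
      show (m : ℝ) < |Z ω| from lt_of_le_of_lt (Nat.cast_le.2 hmn) hω) ⟨0, measure_ne_top _ _⟩
  have he : ⋂ n : ℕ, {ω | (n : ℝ) < |Z ω|} = ∅ := by
    ext ω
    obtain ⟨n, hn⟩ := exists_nat_ge |Z ω|
    simpa using ⟨n, hn⟩
  rw [he, measure_empty] at h
  obtain ⟨n, hn⟩ := (h.eventually_le_const hε).exists
  exact ⟨n, n.cast_nonneg, hn⟩

/-- Boundedness in probability of elementary integrals is stable under absolutely continuous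
changes of measure. -/
theorem integrator_of_absolutelyContinuous {P Q : Measure Ω} [IsFiniteMeasure P]
    [IsFiniteMeasure Q] (hQP : Q ≪ P) {X : Window T → Ω → ℝ} {ℱ : Filtration (Window T) mΩ}
    (h : ∀ ε : ℝ≥0∞, 0 < ε → ∃ C : ℝ, ∀ H : ElementaryIntegrand ℱ,
      P {ω | C < |H.integral X ω|} ≤ ε) (ε : ℝ≥0∞) (hε : 0 < ε) :
    ∃ C : ℝ, ∀ H : ElementaryIntegrand ℱ, Q {ω | C < |H.integral X ω|} ≤ ε := by
  obtain ⟨δ, hδ, hδε⟩ := exists_pos_forall_measure_le_of_absolutelyContinuous hQP hε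
  obtain ⟨C, hC⟩ := h δ hδ
  exact ⟨C, fun H => hδε _ (hC H)⟩

/-- The factor is `X₁` at time `T` whatever `s` and `t` are, because the second increment vanishes
before `T`. It therefore comes out of the elementary integral as a whole. -/
theorem concat_sub_concat (hT : 0 ≤ T) {X₁ X₂ : Window T → Ω → ℝ} {ω : Ω}
    (h : X₂ ⟨0, le_rfl, hT⟩ ω = 1) {s t : Window (2 * T)} (hst : s ≤ t) :
    concat X₁ X₂ t ω - concat X₁ X₂ s ω =
      (X₁ (firstClock t) ω - X₁ (firstClock s) ω) +
        X₁ ⟨T, hT, le_rfl⟩ ω * (X₂ (secondClock t) ω - X₂ (secondClock s) ω) := by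
  rw [concat_eq_mul hT h, concat_eq_mul hT h]
  have hst' : (s : ℝ) ≤ t := hst
  rcases le_or_gt (t : ℝ) T with ht | ht
  · rw [secondClock_of_le hT ht, secondClock_of_le hT (hst'.trans ht), h]
    ring
  · rw [firstClock_of_ge hT ht.le]
    rcases le_or_gt (s : ℝ) T with hs | hs
    · rw [secondClock_of_le hT hs, h]
      ring
    · rw [firstClock_of_ge hT hs.le]
      ring

/-- The integral splits as `I₁ + X₁_T * I₂`. Each `I` is an integral against one component with
weights that also see the independent other path, and `X₁_T` is a single random variable, hence
bounded by some `K` up to small probability. -/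
theorem integrator_concat (hT : 0 ≤ T) {X₁ X₂ : Window T → Ω → ℝ} {Q : Measure Ω}
    [IsProbabilityMeasure Q] (hX₁ : ∀ t, StronglyMeasurable (X₁ t))
    (hX₂ : ∀ t, StronglyMeasurable (X₂ t)) (hI : IndepFun (path X₁) (path X₂) Q)
    (h₁ : ∀ ε : ℝ≥0∞, 0 < ε → ∃ C : ℝ, ∀ H : ElementaryIntegrand (Filtration.natural X₁ hX₁),
      Q {ω | C < |H.integral X₁ ω|} ≤ ε)
    (h₂ : ∀ ε : ℝ≥0∞, 0 < ε → ∃ C : ℝ, ∀ H : ElementaryIntegrand (Filtration.natural X₂ hX₂),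
      Q {ω | C < |H.integral X₂ ω|} ≤ ε)
    (h0 : ∀ᵐ ω ∂Q, X₂ ⟨0, le_rfl, hT⟩ ω = 1) (h : ∀ t, StronglyMeasurable (concat X₁ X₂ t))
    (ε : ℝ≥0∞) (hε : 0 < ε) :
    ∃ C : ℝ, ∀ H : ElementaryIntegrand (Filtration.natural (concat X₁ X₂) h),
      Q {ω | C < |H.integral (concat X₁ X₂) ω|} ≤ ε := by
  have hε3 : 0 < ε / 3 := ENNReal.div_pos hε.ne' (by simp)
  obtain ⟨C₁, hC₁⟩ := h₁ _ hε3
  obtain ⟨C₂, hC₂⟩ := h₂ _ hε3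
  obtain ⟨K, hK0, hK⟩ := exists_measure_lt_abs_le (Q := Q)
    (hX₁ ⟨T, hT, le_rfl⟩).measurable hε3
  refine ⟨C₁ + K * C₂, fun H => ?_⟩
  have hφ : ∀ i, ∃ φ : (Window T → ℝ) × (Window T → ℝ) → ℝ,
      Measurable[(past (firstClock (H.t i))).prod (past (secondClock (H.t i)))] φ ∧
      (∀ z, |φ z| ≤ 1) ∧ ∀ ω, H.h i ω = φ (path X₁ ω, path X₂ ω) := fun i => by
    obtain ⟨φ, hφ, he⟩ := @Measurable.exists_eq_measurable_comp _ _ _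
      ((past (firstClock (H.t i))).prod (past (secondClock (H.t i)))) _ _ _ _ _
      ((H.measurable i).mono (natural_concat_le h _) le_rfl)
    -- The factorisation is controlled only on the range of the pair of paths; clipping bounds it
    -- everywhere and changes nothing there.
    refine ⟨fun z => max (-1) (min 1 (φ z)), measurable_const.max (measurable_const.min hφ),
      fun z => abs_le.2 ⟨le_max_left _ _, max_le (by norm_num) (min_le_left _ _)⟩, fun ω => ?_⟩
    have hb := abs_le.1 (H.bound i ω)
    rw [he] at hb ⊢
    simp only [Function.comp_apply] at hb ⊢
    rw [min_eq_right hb.2, max_eq_right hb.1]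
  choose φ hφm hφ1 hφH using hφ
  set I₁ : Ω → ℝ := fun ω => ∑ i ∈ Finset.range H.n, φ i (path X₁ ω, path X₂ ω) *
    (X₁ (firstClock (H.t (i + 1))) ω - X₁ (firstClock (H.t i)) ω)
  set I₂ : Ω → ℝ := fun ω => ∑ i ∈ Finset.range H.n, φ i (path X₁ ω, path X₂ ω) *
    (X₂ (secondClock (H.t (i + 1))) ω - X₂ (secondClock (H.t i)) ω)
  -- The past of the other component is enlarged to its whole path, which is harmless as that path
  -- will be frozen.
  have b₁ : Q {ω | C₁ < |I₁ ω|} ≤ ε / 3 :=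
    exists_bound_integral_of_indepFun hX₁ (measurable_path hX₂) hI hC₁ H.n
      (firstClock_mono.comp H.mono) (φ := φ)
      (fun i => (hφm i).mono (sup_le_sup le_rfl (MeasurableSpace.comap_mono (past_le _))) le_rfl)
      hφ1
  have b₂ : Q {ω | C₂ < |I₂ ω|} ≤ ε / 3 :=
    exists_bound_integral_of_indepFun hX₂ (measurable_path hX₁) hI.symm hC₂ H.n
      (secondClock_mono.comp H.mono) (φ := fun i z => φ i z.swap)
      (fun i => ((hφm i).mono (sup_le_sup (MeasurableSpace.comap_mono (past_le _)) le_rfl)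
        le_rfl).comp (@measurable_swap _ _ (past (secondClock (H.t i))) MeasurableSpace.pi))
      (fun i z => hφ1 i _)
  have hint : ∀ᵐ ω ∂Q, H.integral (concat X₁ X₂) ω = I₁ ω + X₁ ⟨T, hT, le_rfl⟩ ω * I₂ ω := by
    filter_upwards [h0] with ω hω
    simp only [ElementaryIntegrand.integral, I₁, I₂, Finset.mul_sum, ← Finset.sum_add_distrib]
    refine Finset.sum_congr rfl fun i _ => ?_
    rw [concat_sub_concat hT hω (H.mono i.le_succ), hφH]
    ring
  calc Q {ω | C₁ + K * C₂ < |H.integral (concat X₁ X₂) ω|}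
      ≤ Q ({ω | C₁ < |I₁ ω|} ∪ ({ω | C₂ < |I₂ ω|} ∪ {ω | K < |X₁ ⟨T, hT, le_rfl⟩ ω|})) := by
        refine measure_mono_ae ?_
        filter_upwards [hint] with ω hω hlt
        by_contra hcon'
        have hcon : ¬(C₁ < |I₁ ω| ∨ C₂ < |I₂ ω| ∨ K < |X₁ ⟨T, hT, le_rfl⟩ ω|) := hcon'
        simp only [not_or, not_lt] at hcon
        have hlt' : C₁ + K * C₂ < |H.integral (concat X₁ X₂) ω| := hlt
        rw [hω] at hlt'
        have := abs_add_le (I₁ ω) (X₁ ⟨T, hT, le_rfl⟩ ω * I₂ ω)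
        rw [abs_mul] at this
        have := mul_le_mul hcon.2.2 hcon.2.1 (abs_nonneg _) hK0
        linarith [hcon.1]
    _ ≤ ε / 3 + (ε / 3 + ε / 3) :=
        (measure_union_le _ _).trans (add_le_add b₁ ((measure_union_le _ _).trans
          (add_le_add b₂ hK)))
    _ = ε := by rw [← add_assoc, ENNReal.add_thirds]

/-- The concatenation of two positive semimartingales which are independent under equivalent
pricing measures is a positive semimartingale, with a pricing measure under which the two
components are independent and have the prescribed laws. -/
theorem exists_isPricingMeasure_concat {r : ℝ} (hT : 0 ≤ T) {X₁ X₂ : Window T → Ω → ℝ}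
    {P Q₁ Q₂ : Measure Ω} [IsProbabilityMeasure P]
    (hpos₁ : IsPositiveSemimartingale X₁ P) (hpos₂ : IsPositiveSemimartingale X₂ P)
    (hpr₁ : IsPricingMeasure r X₁ P Q₁) (hpr₂ : IsPricingMeasure r X₂ P Q₂)
    (hI : IndepProcesses X₁ X₂ Q₁) (h0 : ∀ᵐ ω ∂P, X₂ ⟨0, le_rfl, hT⟩ ω = 1) :
    IsPositiveSemimartingale (concat X₁ X₂) P ∧ ∃ Q, IsPricingMeasure r (concat X₁ X₂) P Q ∧
      Q.map (fun ω => (path X₁ ω, path X₂ ω)) =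
        (Q₁.map (path X₁)).prod (Q₂.map (path X₂)) := by
  have hX₁ := hpos₁.stronglyMeasurable
  have hX₂ := hpos₂.stronglyMeasurable
  have hc := stronglyMeasurable_concat hX₁ hX₂
  have := hpr₁.isProbabilityMeasure
  have := hpr₂.isProbabilityMeasure
  obtain ⟨Q, hQ, hQ1, hQ2, hQI, hl₁, hl₂⟩ := exists_indepFun_measure Q₁ Q₂
    (hpr₁.ac.trans hpr₂.ac') (hpr₂.ac.trans hpr₁.ac') (measurable_path hX₁)
    (measurable_path hX₂) hI
  have hQP : Q ≪ P := hQ1.trans hpr₁.ac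
  have hPQ : P ≪ Q := hpr₁.ac'.trans hQ2
  have hpair : Q.map (fun ω => (path X₁ ω, path X₂ ω)) =
      (Q₁.map (path X₁)).prod (Q₂.map (path X₂)) := by
    rw [(indepFun_iff_map_prod_eq_prod_map_map (measurable_path hX₁).aemeasurable
      (measurable_path hX₂).aemeasurable).1 hQI, hl₁, hl₂]
  refine ⟨⟨hc, ?_, ?_, ?_, ?_⟩, Q, ⟨hQ, hQP, hPQ, hc, ?_⟩, hpair⟩
  · filter_upwards [hpos₁.pos, hpos₂.pos, h0] with ω h1 h2 h3 t
    rw [concat_eq_mul hT h3]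
    exact mul_pos (h1 _) (h2 _)
  · exact fun t => (Filtration.stronglyAdapted_natural hc t).measurable
  · filter_upwards [hpos₁.semimartingale.cadlag, hpos₂.semimartingale.cadlag, h0] with ω h1 h2 h3
    simp only [concat_eq_mul hT h3]
    exact (h1.comp_monotone continuous_firstClock firstClock_mono).mul
      (h2.comp_monotone continuous_secondClock secondClock_mono)
  -- The bound travels from `P` to `Q`, where the paths are independent, and back.
  · exact integrator_of_absolutelyContinuous hPQ (integrator_concat hT hX₁ hX₂ hQI
      (integrator_of_absolutelyContinuous hQP hpos₁.semimartingale.integrator)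
      (integrator_of_absolutelyContinuous hQP hpos₂.semimartingale.integrator)
      (hQP.ae_le h0) hc)
  · exact martingale_concat hT hpr₁.martingale hpr₂.martingale hpair (hQP.ae_le h0) hc

end Semimartingale

/-! ### Two-time laws of the components and of the concatenation. -/

section Law

variable {T : ℝ}

/-- The transition is used twice: from 0 to `s` for the law at `s`, then from `s` to `t`. The case
`s = t` is needed since a clock may stand still. -/
theorem SameConditionalExpectations.map_prodMk_eq {ΩX ΩY : Type*} {mX : MeasurableSpace ΩX}
    {mY : MeasurableSpace ΩY} {X : Window T → ΩX → ℝ} {Y : Window T → ΩY → ℝ}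
    {QX : Measure ΩX} {QY : Measure ΩY} [IsProbabilityMeasure QX] [IsProbabilityMeasure QY]
    (h : SameConditionalExpectations X QX Y QY) (hX : ∀ t, StronglyMeasurable (X t))
    (hY : ∀ t, StronglyMeasurable (Y t)) (hT : 0 ≤ T)
    (h0 : QX.map (X ⟨0, le_rfl, hT⟩) = QY.map (Y ⟨0, le_rfl, hT⟩)) {s t : Window T}
    (hst : s ≤ t) :
    QX.map (fun ω => (X s ω, X t ω)) = QY.map (fun ω => (Y s ω, Y t ω)) := by
  have step : ∀ s t : Window T, s ≤ t → QX.map (X s) = QY.map (Y s) →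
      QX.map (fun ω => (X s ω, X t ω)) = QY.map (fun ω => (Y s ω, Y t ω)) := by
    intro s t hst hs
    rcases hst.eq_or_lt with rfl | hlt
    · have := congrArg (Measure.map fun x : ℝ => (x, x)) hs
      rwa [Measure.map_map (by fun_prop) (hX s).measurable,
        Measure.map_map (by fun_prop) (hY s).measurable] at this
    · exact map_prodMk_eq_of_condExp_eq (hX s).measurable (hX t).measurable (hY s).measurable
        (hY t).measurable hs (h s t hlt)
  refine step s t hst ?_
  have := congrArg (Measure.map Prod.snd) (step ⟨0, le_rfl, hT⟩ s s.2.1 h0)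
  rwa [Measure.map_map measurable_snd ((hX _).measurable.prodMk (hX s).measurable),
    Measure.map_map measurable_snd ((hY _).measurable.prodMk (hY s).measurable)] at this

theorem map_concat_prodMk {Ω : Type*} {mΩ : MeasurableSpace Ω} (hT : 0 ≤ T)
    {X₁ X₂ : Window T → Ω → ℝ} {Q Q₁ Q₂ : Measure Ω} [IsProbabilityMeasure Q₁]
    [IsProbabilityMeasure Q₂] (hX₁ : ∀ t, StronglyMeasurable (X₁ t))
    (hX₂ : ∀ t, StronglyMeasurable (X₂ t))
    (hQ : Q.map (fun ω => (path X₁ ω, path X₂ ω)) = (Q₁.map (path X₁)).prod (Q₂.map (path X₂)))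
    (h0 : ∀ᵐ ω ∂Q, X₂ ⟨0, le_rfl, hT⟩ ω = 1) (s t : Window (2 * T)) :
    Q.map (fun ω => (concat X₁ X₂ s ω, concat X₁ X₂ t ω)) =
      ((Q₁.map fun ω => (X₁ (firstClock s) ω, X₁ (firstClock t) ω)).prod
        (Q₂.map fun ω => (X₂ (secondClock s) ω, X₂ (secondClock t) ω))).map
        fun z => (z.1.1 * z.2.1, z.1.2 * z.2.2) := by
  have hev : ∀ a b : Window T, Measurable fun x : Window T → ℝ => (x a, x b) := fun a b => by
    fun_prop
  have e₁ : (Q₁.map fun ω => (X₁ (firstClock s) ω, X₁ (firstClock t) ω)) =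
      (Q₁.map (path X₁)).map fun x => (x (firstClock s), x (firstClock t)) := by
    rw [Measure.map_map (hev _ _) (measurable_path hX₁)]; rfl
  have e₂ : (Q₂.map fun ω => (X₂ (secondClock s) ω, X₂ (secondClock t) ω)) =
      (Q₂.map (path X₂)).map fun x => (x (secondClock s), x (secondClock t)) := by
    rw [Measure.map_map (hev _ _) (measurable_path hX₂)]; rfl
  have := Measure.isProbabilityMeasure_map (μ := Q₁) (measurable_path hX₁).aemeasurable
  have := Measure.isProbabilityMeasure_map (μ := Q₂) (measurable_path hX₂).aemeasurable
  rw [e₁, e₂, Measure.map_prod_map _ _ (hev _ _) (hev _ _), ← hQ,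
    Measure.map_map ((hev _ _).prodMap (hev _ _))
      ((measurable_path hX₁).prodMk (measurable_path hX₂)),
    Measure.map_map (by fun_prop) (((hev _ _).prodMap (hev _ _)).comp
      ((measurable_path hX₁).prodMk (measurable_path hX₂)))]
  refine Measure.map_congr ?_
  filter_upwards [h0] with ω hω
  simp only [concat_eq_mul hT hω]
  rfl

end Law

end NAP

/-! ### The proposition, assembled from pricing measures and two-time laws. -/

theorem proposition1p1 {ΩX ΩY : Type*} [MeasurableSpace ΩX] [MeasurableSpace ΩY]
    (PX : Measure ΩX) [IsProbabilityMeasure PX] (PY : Measure ΩY) [IsProbabilityMeasure PY]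
    (r T : ℝ) (hT : 0 < T)
    (X₁ X₂ : NAP.Window T → ΩX → ℝ) (Y₁ Y₂ : NAP.Window T → ΩY → ℝ)
    -- the pricing measures of the two pairs
    (QX₁ QX₂ : Measure ΩX) (QY₁ QY₂ : Measure ΩY)
    (h₁ : NAP.NAPEquivalentVia r X₁ PX QX₁ Y₁ PY QY₁)
    (h₂ : NAP.NAPEquivalentVia r X₂ PX QX₂ Y₂ PY QY₂)
    (hMX₁ : NAP.IsTimeHomogeneousMarkov X₁ QX₁) (hMY₁ : NAP.IsTimeHomogeneousMarkov Y₁ QY₁)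
    (hMX₂ : NAP.IsTimeHomogeneousMarkov X₂ QX₂) (hMY₂ : NAP.IsTimeHomogeneousMarkov Y₂ QY₂)
    (hIX₁ : NAP.IndepProcesses X₁ X₂ QX₁) (hIX₂ : NAP.IndepProcesses X₁ X₂ QX₂)
    (hIY₁ : NAP.IndepProcesses Y₁ Y₂ QY₁) (hIY₂ : NAP.IndepProcesses Y₁ Y₂ QY₂)
    -- the first components have the same initial law under the pricing measures
    (hinit : QX₁.map (X₁ ⟨0, le_rfl, hT.le⟩) = QY₁.map (Y₁ ⟨0, le_rfl, hT.le⟩))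
    (hX₂ : ∀ᵐ ω ∂PX, X₂ ⟨0, le_rfl, hT.le⟩ ω = 1)
    (hY₂ : ∀ᵐ ω ∂PY, Y₂ ⟨0, le_rfl, hT.le⟩ ω = 1) :
    NAP.NAPEquivalent r (NAP.concat X₁ X₂) PX (NAP.concat Y₁ Y₂) PY := by
  have := h₁.pricingX.isProbabilityMeasure
  have := h₁.pricingY.isProbabilityMeasure
  have := h₂.pricingX.isProbabilityMeasure
  have := h₂.pricingY.isProbabilityMeasure
  have mX₁ := h₁.posX.stronglyMeasurable
  have mX₂ := h₂.posX.stronglyMeasurable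
  have mY₁ := h₁.posY.stronglyMeasurable
  have mY₂ := h₂.posY.stronglyMeasurable
  obtain ⟨hpX, QX, hQX, hlX⟩ := NAP.exists_isPricingMeasure_concat hT.le h₁.posX h₂.posX
    h₁.pricingX h₂.pricingX hIX₁ hX₂
  obtain ⟨hpY, QY, hQY, hlY⟩ := NAP.exists_isPricingMeasure_concat hT.le h₁.posY h₂.posY
    h₁.pricingY h₂.pricingY hIY₁ hY₂
  have := hQX.isProbabilityMeasure
  have := hQY.isProbabilityMeasure
  -- Both initial laws are the Dirac mass at 1.
  have hinit₂ : QX₂.map (X₂ ⟨0, le_rfl, hT.le⟩) = QY₂.map (Y₂ ⟨0, le_rfl, hT.le⟩) := by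
    rw [Measure.map_congr (g := fun _ => 1) (h₂.pricingX.ac.ae_le hX₂),
      Measure.map_congr (g := fun _ => 1) (h₂.pricingY.ac.ae_le hY₂), Measure.map_const,
      Measure.map_const, measure_univ, measure_univ]
  refine ⟨QX, QY, hpX, hpY, hQX, hQY, fun s t hst f hf ⟨C, hC⟩ => ?_⟩
  refine NAP.exists_condExp_version_of_map_eq (hpX.stronglyMeasurable s).measurable
    (hpX.stronglyMeasurable t).measurable (hpY.stronglyMeasurable s).measurable
    (hpY.stronglyMeasurable t).measurable ?_ hf hC
  rw [NAP.map_concat_prodMk hT.le mX₁ mX₂ hlX (hQX.ac.ae_le hX₂),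
    NAP.map_concat_prodMk hT.le mY₁ mY₂ hlY (hQY.ac.ae_le hY₂),
    h₁.same.map_prodMk_eq mX₁ mY₁ hT.le hinit (NAP.firstClock_mono hst.le),
    h₂.same.map_prodMk_eq mX₂ mY₂ hT.le hinit₂ (NAP.secondClock_mono hst.le)]
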